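/- Let $G$ be a finite simple graph on $n \ge 4$ vertices whose edges are colored arbitrarily (adjacent edges may receive the same color). For a vertex $v$, let the color degree $d^c(v)$ be the number of distinct colors appearing on the edges incident to $v$. If $d^c(v) \ge \frac{n+1}{2}$ for every vertex $v$ of $G$, then $G$ contains a properly colored $C_4$, that is, a (not necessarily induced) subgraph that is a cycle on four vertices in which any two adjacent edges have distinct colors. -/

import Mathlib

namespace EdgeColored

/-- The color degree of a vertex `v` in a graph `G` whose edges are colored by `c` (an arbitrary
assignment of colors to edges): the number of colors appearing on the edges incident to `v`. -/
noncomputable def colorDegree {V K : Type*} {G : SimpleGraph V} (c : G.EdgeLabeling K) (v : V) :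
    ℕ :=
  {k : K | ∃ w : V, ∃ h : G.Adj v w, c.get v w h = k}.ncard

/-- A subgraph `H` of an edge-colored graph is properly colored if any two distinct edges of `H`
that share an endpoint have distinct colors. -/
def IsProperlyColored {V K : Type*} {G : SimpleGraph V} (c : G.EdgeLabeling K) (H : G.Subgraph) :
    Prop :=
  ∀ (v w w' : V) (h : H.Adj v w) (h' : H.Adj v w'), w ≠ w' →
    c.get v w h.adj_sub ≠ c.get v w' h'.adj_sub

/-- The edge-colored graph contains a properly colored copy of `F`: some subgraph (not necessarily
induced) is isomorphic to `F` and properly colored. -/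
def ContainsProperlyColored {V K W : Type*} {G : SimpleGraph V} (c : G.EdgeLabeling K)
    (F : SimpleGraph W) : Prop :=
  ∃ H : G.Subgraph, Nonempty (F ≃g H.coe) ∧ IsProperlyColored c H

end EdgeColored

open Finset

namespace EdgeColored

/-! ### Arcs, star forests and cores -/

section PCFourCycle

open scoped Classical

variable {V C : Type*}

/-! Write n for the number of vertices. In an edge-minimal spanning subgraph with all color degrees
at least (n+1)/2, every edge has a color unique at one of its ends (`exists_starForest`); orient it
towards that end. An arc never has a color conflict at its head, so four-cycles are built from arcs.

If there is no properly colored four-cycle, `exists_isCore` shows by induction on n that a color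
degree sum of at least n(n+1)/2 equals n(n+1)/2 and forces a core. Deleting x costs at most its
color degree plus its out-degree. If this is at most n for some x, the deletion is tight and the
smaller core extends (`IsCore.extend`). Otherwise, counting disjoint sets of heads puts the sum
below n(n+1)/2 (`Dense.two_mul_sum_lt`).

A core vertex has color degree n-1 > (n+1)/2, which contradicts the equality. -/

/-- The edge `xy` has a color that no other edge at `y` has. -/
def OutArc (H : SimpleGraph V) (k : V → V → C) (x y : V) : Prop :=
  H.Adj x y ∧ ∀ z, H.Adj z y → k z y = k x y → z = x

/-- Every color class is a star forest. -/
def StarForest (H : SimpleGraph V) (k : V → V → C) : Prop :=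
  ∀ x y, H.Adj x y → OutArc H k x y ∨ OutArc H k y x

/-- There is no properly colored four-cycle. -/
def NoPCFour (H : SimpleGraph V) (k : V → V → C) : Prop :=
  ∀ a b c d, H.Adj a b → H.Adj b c → H.Adj c d → H.Adj d a →
    k b a ≠ k b c → k c b ≠ k c d → k d c ≠ k d a → k a d ≠ k a b → False

/-- The graph in which the vertex `x` has been isolated. -/
def isolate (H : SimpleGraph V) (x : V) : SimpleGraph V where
  Adj y z := H.Adj y z ∧ y ≠ x ∧ z ≠ x
  symm := ⟨fun _ _ h => ⟨h.1.symm, h.2.2, h.2.1⟩⟩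
  loopless := ⟨fun _ h => h.1.ne rfl⟩

variable {H : SimpleGraph V} {k : V → V → C}

lemma OutArc.ne_color (hk : ∀ x y, k x y = k y x) {x y z : V} (h : OutArc H k x y)
    (hz : H.Adj y z) (hne : z ≠ x) : k y x ≠ k y z := by
  intro e
  exact hne (h.2 z hz.symm (by rw [hk z y, hk x y, e]))

lemma StarForest.isolate (h : StarForest H k) (x : V) : StarForest (isolate H x) k := by
  have key : ∀ y z, (EdgeColored.isolate H x).Adj y z → OutArc H k y z →
      OutArc (EdgeColored.isolate H x) k y z :=
    fun y z ha ho => ⟨ha, fun w hw e => ho.2 w hw.1 e⟩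
  intro y z ha
  exact (h y z ha.1).imp (key y z ha) (key z y ha.symm)

lemma NoPCFour.mono {H' : SimpleGraph V} (h : NoPCFour H k) (hle : H' ≤ H) : NoPCFour H' k :=
  fun a b c d h1 h2 h3 h4 => h a b c d (hle h1) (hle h2) (hle h3) (hle h4)

lemma isolate_le (x : V) : isolate H x ≤ H := fun _ _ h => h.1

lemma StarForest.outArc_of_color_eq (hk : ∀ x y, k x y = k y x) (h : StarForest H k) {x y z : V}
    (hy : H.Adj x y) (hz : H.Adj x z) (hne : y ≠ z) (e : k x y = k x z) : OutArc H k x y := by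
  refine (h x y hy).resolve_right fun ho => ho.ne_color hk hz hne.symm e

/-- `T` is a triple, each of whose vertices is joined to all of `U` by edges of distinct colors. -/
def IsCore (H : SimpleGraph V) (k : V → V → C) (U T : Finset V) : Prop :=
  T ⊆ U ∧ #T = 3 ∧ ∀ t ∈ T, ∀ z ∈ U, z ≠ t → OutArc H k z t

lemma exists_third {T : Finset V} (hT : #T = 3) (a b : V) : ∃ c ∈ T, c ≠ a ∧ c ≠ b := by
  have : ({a, b} : Finset V).card < #T := by
    have := card_le_two (a := a) (b := b)
    omega
  obtain ⟨c, hc, hn⟩ := exists_mem_notMem_of_card_lt_card this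
  simp only [mem_insert, mem_singleton, not_or] at hn
  exact ⟨c, hc, hn.1, hn.2⟩

/-! ### Extending a core to a deleted vertex -/

section Extend

variable {U T : Finset V} {x : V}

/-- Two arcs of different colors leaving `x` would close up through a core vertex `t` to the
properly colored cycle `x y t z`. -/
lemma IsCore.outColor_unique (hk : ∀ x y, k x y = k y x) (hU : ∀ x y, H.Adj x y → x ∈ U)
    (h4 : NoPCFour H k) (hT : IsCore (isolate H x) k (U.erase x) T) {y z : V}
    (hy : OutArc H k x y) (hz : OutArc H k x z) : k x y = k x z := by
  obtain ⟨hTU, hT3, hT⟩ := hT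
  have mem : ∀ {y}, OutArc H k x y → y ∈ U.erase x := fun {y} h =>
    mem_erase.2 ⟨h.1.ne', hU _ _ h.1.symm⟩
  by_contra hne
  have hyz : y ≠ z := by rintro rfl; exact hne rfl
  obtain ⟨t, ht, hty, htz⟩ := exists_third hT3 y z
  have a1 := hT t ht y (mem hy) hty.symm
  have a2 := hT t ht z (mem hz) htz.symm
  exact h4 x y t z hy.1 a1.1.1 a2.1.1.symm hz.1.symm (hy.ne_color hk a1.1.1 a1.1.2.2)
    (a1.ne_color hk a2.1.symm hyz.symm) (hz.ne_color hk a2.1.1 a1.1.2.2).symm (Ne.symm hne)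

/-- In the cycle `x w t' t` no conflict is possible at `w` (head of an arc) or at `t'` (core
vertex), so it occurs at `t` or `x`. -/
lemma IsCore.color_eq_or (hk : ∀ x y, k x y = k y x) (hU : ∀ x y, H.Adj x y → x ∈ U)
    (h4 : NoPCFour H k) (hT : IsCore (isolate H x) k (U.erase x) T) {w t t' : V}
    (hw : OutArc H k x w) (ht : t ∈ T) (ht' : t' ∈ T) (htt : t ≠ t') (hwt : w ≠ t) (hwt' : w ≠ t')
    (hx : H.Adj x t) : k t t' = k t x ∨ k x t = k x w := by
  obtain ⟨hTU, hT3, hT⟩ := hT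
  have a1 := hT t' ht' w (mem_erase.2 ⟨hw.1.ne', hU _ _ hw.1.symm⟩) hwt'
  have a2 := hT t' ht' t (hTU ht) htt
  by_contra! hne
  exact h4 x w t' t hw.1 a1.1.1 a2.1.1.symm hx.symm (hw.ne_color hk a1.1.1 a1.1.2.2)
    (a1.ne_color hk a2.1.symm hwt.symm) hne.1 hne.2

lemma IsCore.color_eq (hk : ∀ x y, k x y = k y x) (hU : ∀ x y, H.Adj x y → x ∈ U)
    (h4 : NoPCFour H k) (hs : StarForest H k) (hT : IsCore (isolate H x) k (U.erase x) T)
    (hadj : ∀ t ∈ T, H.Adj x t) {w t : V} (hw : OutArc H k x w) (ht : t ∈ T) (hwt : w ≠ t) :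
    k x t = k x w := by
  have hcolor : ∀ {t t' t''}, t ∈ T → t' ∈ T → t'' ∈ T → t' ≠ t → t'' ≠ t → t'' ≠ t' →
      k t t' ≠ k t t'' := by
    intro t t' t'' ht ht' ht'' h1 h2 h3
    have a1 := hT.2.2 t ht t' (hT.1 ht') h1
    exact a1.ne_color hk (hT.2.2 t ht t'' (hT.1 ht'') h2).1.symm h3
  obtain ⟨t', ht', htw', htt'⟩ := exists_third hT.2.1 w t
  rcases hT.color_eq_or hk hU h4 hw ht ht' htt'.symm hwt htw'.symm (hadj t ht) with h1 | h1
  swap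
  · exact h1
  by_cases hwT : w ∈ T
  · rcases hT.color_eq_or hk hU h4 hw ht' ht htt' htw'.symm hwt (hadj t' ht') with h2 | h2
    · exfalso
      -- The triangle `x t t'` would be monochromatic, which a star forest excludes.
      have a := hT.2.2 t ht t' (hT.1 ht') htt'
      rcases hs t t' a.1.1.symm with ho | ho
      · exact ho.ne_color hk (hadj t' ht').symm (hadj t ht).ne h2
      · exact ho.ne_color hk (hadj t ht).symm (hadj t' ht').ne h1
    · have ho : OutArc H k x t' := hs.outArc_of_color_eq hk (hadj t' ht') hw.1 htw' h2
      rcases hT.color_eq_or hk hU h4 ho ht hwT hwt.symm htt' htw' (hadj t ht) with h3 | h3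
      · exact absurd (h1.trans h3.symm) (hcolor ht ht' hwT htt' hwt htw'.symm)
      · exact h3.trans h2
  · obtain ⟨t'', ht'', h2, h3⟩ := exists_third hT.2.1 t t'
    have hwt'' : w ≠ t'' := by rintro rfl; exact hwT ht''
    rcases hT.color_eq_or hk hU h4 hw ht ht'' h2.symm hwt hwt'' (hadj t ht) with h5 | h5
    · exact absurd (h1.trans h5.symm) (hcolor ht ht' ht'' htt' h2 h3)
    · exact h5

lemma IsCore.extend (hk : ∀ x y, k x y = k y x) (hU : ∀ x y, H.Adj x y → x ∈ U)
    (h4 : NoPCFour H k) (hs : StarForest H k) (hT : IsCore (isolate H x) k (U.erase x) T)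
    (hadj : ∀ t ∈ T, H.Adj x t) {w : V} (hw : OutArc H k x w) : IsCore H k U T := by
  have hx : ∀ t ∈ T, OutArc H k x t := by
    intro t ht
    by_cases hwt : w = t
    · exact hwt ▸ hw
    · exact hs.outArc_of_color_eq hk (hadj t ht) hw.1 (Ne.symm hwt)
        (hT.color_eq hk hU h4 hs hadj hw ht hwt)
  refine ⟨hT.1.trans (erase_subset _ _), hT.2.1, fun t ht z hz hne => ?_⟩
  by_cases hzx : z = x
  · exact hzx ▸ hx t ht
  have ho := hT.2.2 t ht z (mem_erase.2 ⟨hzx, hz⟩) hne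
  refine ⟨ho.1.1, fun y hy e => ?_⟩
  by_cases hyx : y = x
  · subst hyx
    exact absurd ((hx t ht).2 z ho.1.1 e.symm) hzx
  · exact ho.2 y ⟨hy, hyx, ho.1.2.2⟩ e
end Extend

/-! ### Counting colors, and their loss under vertex deletion -/

variable [Fintype V]

/-- The neighbors of `v`. -/
noncomputable def nbrs (H : SimpleGraph V) (v : V) : Finset V := univ.filter (H.Adj v)

/-- The colors at `v`. -/
noncomputable def colorsAt (H : SimpleGraph V) (k : V → V → C) (v : V) : Finset C :=
  (nbrs H v).image (k v)

/-- The heads of the arcs leaving `v`. -/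
noncomputable def outNbrs (H : SimpleGraph V) (k : V → V → C) (v : V) : Finset V :=
  univ.filter (OutArc H k v)

/-- The colors of the arcs leaving `v`. -/
noncomputable def outColors (H : SimpleGraph V) (k : V → V → C) (v : V) : Finset C :=
  (outNbrs H k v).image (k v)

lemma mem_nbrs {v w : V} : w ∈ nbrs H v ↔ H.Adj v w := by simp [nbrs]

lemma mem_outNbrs {v w : V} : w ∈ outNbrs H k v ↔ OutArc H k v w := by simp [outNbrs]

lemma outNbrs_subset_nbrs (v : V) : outNbrs H k v ⊆ nbrs H v := by
  intro w hw
  exact mem_nbrs.2 (mem_outNbrs.1 hw).1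

lemma card_colorsAt_le (v : V) : #(colorsAt H k v) ≤ #(nbrs H v) := card_image_le

lemma card_colorsAt_add_card_outNbrs_le (v : V) :
    #(colorsAt H k v) + #(outNbrs H k v) ≤ #(nbrs H v) + #(outColors H k v) := by
  have h1 : colorsAt H k v = (nbrs H v \ outNbrs H k v).image (k v) ∪ outColors H k v := by
    rw [colorsAt, outColors, ← image_union, sdiff_union_of_subset (outNbrs_subset_nbrs v)]
  have h2 : #(colorsAt H k v) ≤ #(nbrs H v \ outNbrs H k v) + #(outColors H k v) := by
    rw [h1]
    exact (card_union_le _ _).trans (Nat.add_le_add_right card_image_le _)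
  have h3 := card_sdiff_add_card_eq_card (outNbrs_subset_nbrs (H := H) (k := k) v)
  omega

lemma nbrs_subset_erase {U : Finset V} (hU : ∀ x y, H.Adj x y → x ∈ U) (v : V) :
    nbrs H v ⊆ U.erase v := by
  intro w hw
  have := mem_nbrs.1 hw
  exact mem_erase.2 ⟨this.ne', hU _ _ this.symm⟩

lemma card_nbrs_lt {U : Finset V} (hU : ∀ x y, H.Adj x y → x ∈ U) {v : V} (hv : v ∈ U) :
    #(nbrs H v) + 1 ≤ #U := by
  rw [← card_erase_add_one hv]
  exact Nat.add_le_add_right (card_le_card (nbrs_subset_erase hU v)) 1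

lemma adj_of_card_nbrs {U : Finset V} (hU : ∀ x y, H.Adj x y → x ∈ U) {v w : V} (hv : v ∈ U)
    (hc : #U ≤ #(nbrs H v) + 1) (hw : w ∈ U) (hne : w ≠ v) : H.Adj v w := by
  have h := eq_of_subset_of_card_le (nbrs_subset_erase hU v)
    (by have := card_erase_add_one hv; omega)
  exact mem_nbrs.1 (h ▸ mem_erase.2 ⟨hne, hw⟩)

lemma colorsAt_eq_empty {U : Finset V} (hU : ∀ x y, H.Adj x y → x ∈ U) {v : V} (hv : v ∉ U) :
    colorsAt H k v = ∅ := by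
  rw [colorsAt, image_eq_empty, eq_empty_iff_forall_notMem]
  intro w hw
  exact hv (hU _ _ (mem_nbrs.1 hw))

/-- Only the head of an arc leaving `x` loses a color, since any other neighbor sees the color of
its edge to `x` a second time. -/
lemma colorsAt_subset_isolate (hk : ∀ x y, k x y = k y x) {x v : V} (hv : v ≠ x) :
    colorsAt H k v ⊆ colorsAt (isolate H x) k v ∪ if v ∈ outNbrs H k x then {k v x} else ∅ := by
  intro a ha
  obtain ⟨w, hw, rfl⟩ := mem_image.1 ha
  rw [mem_nbrs] at hw
  rw [mem_union]
  by_cases hwx : w = x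
  · subst hwx
    by_cases ho : v ∈ outNbrs H k w
    · right; simp [ho]
    · left
      rw [mem_outNbrs, OutArc] at ho
      push Not at ho
      obtain ⟨z, hz, e, hne⟩ := ho hw.symm
      refine mem_image.2 ⟨z, mem_nbrs.2 ⟨hz.symm, hv, hne⟩, ?_⟩
      rw [hk v z, e, hk]
  · left
    exact mem_image.2 ⟨w, mem_nbrs.2 ⟨hw, hv, hwx⟩, rfl⟩

lemma sum_colorsAt_le_isolate (hk : ∀ x y, k x y = k y x) (x : V) :
    ∑ v, #(colorsAt H k v) ≤
      ∑ v, #(colorsAt (isolate H x) k v) + (#(colorsAt H k x) + #(outNbrs H k x)) := by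
  have h : ∀ v, #(colorsAt H k v) ≤ #(colorsAt (isolate H x) k v) +
      ((if v = x then #(colorsAt H k x) else 0) + if v ∈ outNbrs H k x then 1 else 0) := by
    intro v
    by_cases hv : v = x
    · subst hv
      simp only [if_true]
      omega
    · refine (card_le_card (colorsAt_subset_isolate hk hv)).trans ((card_union_le _ _).trans ?_)
      split_ifs <;> simp
  refine (sum_le_sum fun v _ => h v).trans ?_
  rw [sum_add_distrib, sum_add_distrib]
  simp


/-! ### The case where no vertex can be deleted -/

section Dense

variable {U : Finset V}

/-- The heads, other than `v`, of the arcs leaving `x` whose color differs from that of `xv`. -/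
noncomputable def goodHeads (H : SimpleGraph V) (k : V → V → C) (v x : V) : Finset V :=
  (outNbrs H k x).filter fun y => y ≠ v ∧ k x y ≠ k x v

lemma mem_goodHeads {v x y : V} :
    y ∈ goodHeads H k v x ↔ OutArc H k x y ∧ y ≠ v ∧ k x y ≠ k x v := by
  simp [goodHeads, mem_outNbrs]

lemma card_outColors_le_goodHeads (v x : V) :
    #(outColors H k x) ≤ #(goodHeads H k v x) + 1 := by
  have : outColors H k x ⊆ insert (k x v) ((goodHeads H k v x).image (k x)) := by
    intro a ha
    obtain ⟨y, hy, rfl⟩ := mem_image.1 ha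
    rw [mem_insert]
    by_cases e : k x y = k x v
    · exact Or.inl e
    · refine Or.inr (mem_image_of_mem _ (mem_goodHeads.2 ⟨mem_outNbrs.1 hy, ?_, e⟩))
      rintro rfl
      exact e rfl
  exact (card_le_card this).trans ((card_insert_le _ _).trans (Nat.add_le_add_right card_image_le _))

/-- A common head `y` would give the properly colored cycle `v x₁ y x₂`. -/
lemma goodHeads_disjoint (hk : ∀ x y, k x y = k y x) (h4 : NoPCFour H k) {v x₁ x₂ : V}
    (hx₁ : H.Adj v x₁) (hx₂ : H.Adj v x₂) (hne : k v x₁ ≠ k v x₂) :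
    Disjoint (goodHeads H k v x₁) (goodHeads H k v x₂) := by
  rw [disjoint_left]
  intro y h1 h2
  obtain ⟨o1, -, e1⟩ := mem_goodHeads.1 h1
  obtain ⟨o2, -, e2⟩ := mem_goodHeads.1 h2
  refine h4 v x₁ y x₂ hx₁ o1.1 o2.1.symm hx₂.symm e1.symm (o1.ne_color hk o2.1.symm ?_) e2 hne.symm
  rintro rfl
  exact hne rfl

/-- A set of neighbors of `v` that has every color at `v` exactly once. -/
def IsReps (H : SimpleGraph V) (k : V → V → C) (v : V) (S : Finset V) : Prop :=
  S ⊆ nbrs H v ∧ Set.InjOn (k v) S ∧ S.image (k v) = colorsAt H k v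

lemma exists_isReps (v : V) : ∃ S, IsReps H k v S := by
  obtain ⟨S, hS, hb⟩ := Set.exists_subset_bijOn (nbrs H v : Set V) (k v)
  have hfin : S.Finite := Set.toFinite S
  refine ⟨hfin.toFinset, by simpa using hS, by simpa using hb.injOn, ?_⟩
  rw [← coe_inj]
  simpa [colorsAt] using hb.image_eq

lemma IsReps.card {v : V} {S : Finset V} (hS : IsReps H k v S) : #S = #(colorsAt H k v) := by
  rw [← hS.2.2, card_image_of_injOn hS.2.1]

lemma IsReps.mem_of_outArc (hk : ∀ x y, k x y = k y x) {v x : V} {S : Finset V}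
    (hS : IsReps H k v S) (hx : OutArc H k x v) : x ∈ S := by
  have : k v x ∈ S.image (k v) := by
    rw [hS.2.2]
    exact mem_image_of_mem _ (mem_nbrs.2 hx.1.symm)
  obtain ⟨y, hy, e⟩ := mem_image.1 this
  have := hx.2 y (mem_nbrs.1 (hS.1 hy)).symm (by rw [hk y, e, hk])
  exact this ▸ hy

lemma goodHeads_eq_singleton_of_mem (hk : ∀ x y, k x y = k y x) (hs : StarForest H k)
    {v x₁ x₂ : V} (hx₁ : H.Adj v x₁) (hx₂ : H.Adj v x₂)
    (h₁ : #(goodHeads H k v x₁) = 1) (h₂ : goodHeads H k v x₂ = {x₁}) :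
    goodHeads H k v x₁ = {x₂} := by
  have m := mem_goodHeads.1 (h₂ ▸ mem_singleton_self x₁ : x₁ ∈ goodHeads H k v x₂)
  obtain ⟨o, -, e⟩ := m
  -- A second edge at `x₂` of the same color would be an arc leaving `x₂`, hence would give a second
  -- good head.
  have o' : OutArc H k x₁ x₂ := by
    refine ⟨o.1.symm, fun z hz ez => ?_⟩
    by_contra hne
    have ho := hs.outArc_of_color_eq hk hz.symm o.1 hne (by rw [hk x₂ z, ez, hk])
    have hzx : k x₂ z = k x₂ x₁ := by rw [hk x₂ z, ez, hk]
    have hzv : z ≠ v := by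
      rintro rfl
      exact e hzx.symm
    have : z ∈ goodHeads H k v x₂ := mem_goodHeads.2 ⟨ho, hzv, by rwa [hzx]⟩
    rw [h₂, mem_singleton] at this
    exact hne this
  obtain ⟨y, hy⟩ := card_eq_one.1 h₁
  have hm : x₂ ∈ goodHeads H k v x₁ :=
    mem_goodHeads.2 ⟨o', hx₂.ne', o.ne_color hk hx₁.symm hx₂.ne⟩
  rw [hy, mem_singleton] at hm
  rw [hy, hm]

lemma goodHeads_eq_singleton (hk : ∀ x y, k x y = k y x) (hU : ∀ x y, H.Adj x y → x ∈ U)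
    (h4 : NoPCFour H k) (hs : StarForest H k) {v x₁ x₂ : V} (hx₁ : H.Adj v x₁) (hx₂ : H.Adj v x₂)
    (hne : k v x₁ ≠ k v x₂) (h₁ : #(goodHeads H k v x₁) = 1) (h₂ : #(goodHeads H k v x₂) = 1)
    (f₁ : #U ≤ #(nbrs H x₁) + 1) (f₂ : #U ≤ #(nbrs H x₂) + 1) :
    goodHeads H k v x₁ = {x₂} := by
  obtain ⟨y₁, e₁⟩ := card_eq_one.1 h₁
  obtain ⟨y₂, e₂⟩ := card_eq_one.1 h₂
  by_cases hyx : y₁ = x₂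
  · rw [e₁, hyx]
  by_cases hyx' : y₂ = x₁
  · exact goodHeads_eq_singleton_of_mem hk hs hx₁ hx₂ h₁ (hyx' ▸ e₂)
  exfalso
  obtain ⟨o₁, v₁, c₁⟩ := mem_goodHeads.1 (e₁ ▸ mem_singleton_self y₁ : y₁ ∈ goodHeads H k v x₁)
  obtain ⟨o₂, v₂, c₂⟩ := mem_goodHeads.1 (e₂ ▸ mem_singleton_self y₂ : y₂ ∈ goodHeads H k v x₂)
  have hxx : x₁ ≠ x₂ := by
    rintro rfl
    exact hne rfl
  -- Otherwise `v x y x'` is properly colored. Applied both ways, this makes `x₁ y₁ x₂ y₂` properly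
  -- colored.
  have cross : ∀ {x x' y : V}, H.Adj v x → H.Adj v x' → k v x ≠ k v x' →
      OutArc H k x y → k x y ≠ k x v → H.Adj x' y → k x' y = k x' v := by
    intro x x' y hx hx' hc ho hv ha
    by_contra hn
    refine h4 v x y x' hx ho.1 ha.symm hx'.symm hv.symm (ho.ne_color hk ha.symm ?_) hn hc.symm
    rintro rfl
    exact hc rfl
  have a₁ := adj_of_card_nbrs hU (hU _ _ hx₂.symm) f₂ (hU _ _ o₁.1.symm) hyx
  have a₂ := adj_of_card_nbrs hU (hU _ _ hx₁.symm) f₁ (hU _ _ o₂.1.symm) hyx'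
  have b₁ := cross hx₁ hx₂ hne o₁ c₁ a₁
  have b₂ := cross hx₂ hx₁ hne.symm o₂ c₂ a₂
  exact h4 x₁ y₁ x₂ y₂ o₁.1 a₁.symm o₂.1 a₂.symm (o₁.ne_color hk a₁.symm hxx.symm)
    (by rw [b₁]; exact c₂.symm) (o₂.ne_color hk a₂.symm hxx) (by rw [b₂]; exact c₁.symm)

/-- The vertices of `S` with exactly one good head. -/
noncomputable def thin (H : SimpleGraph V) (k : V → V → C) (v : V) (S : Finset V) : Finset V :=
  S.filter fun x => #(goodHeads H k v x) = 1

variable {v : V} {S : Finset V}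

lemma IsReps.sum_goodHeads_le (hk : ∀ x y, k x y = k y x) (hU : ∀ x y, H.Adj x y → x ∈ U)
    (h4 : NoPCFour H k) (hS : IsReps H k v S) (hv : v ∈ U) :
    ∑ x ∈ S, #(goodHeads H k v x) + 1 ≤ #U := by
  rw [← card_biUnion, ← card_erase_add_one hv]
  · refine Nat.add_le_add_right (card_le_card fun y hy => ?_) 1
    obtain ⟨x, -, hy⟩ := mem_biUnion.1 hy
    obtain ⟨o, hyv, -⟩ := mem_goodHeads.1 hy
    exact mem_erase.2 ⟨hyv, hU _ _ o.1.symm⟩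
  · intro x hx y hy hne
    exact goodHeads_disjoint hk h4 (mem_nbrs.1 (hS.1 hx)) (mem_nbrs.1 (hS.1 hy))
      fun e => hne (hS.2.1 hx hy e)

/-- Hypotheses under which no vertex can be deleted. -/
structure Dense (H : SimpleGraph V) (k : V → V → C) (U : Finset V) : Prop where
  symm : ∀ x y, k x y = k y x
  mem : ∀ x y, H.Adj x y → x ∈ U
  noFour : NoPCFour H k
  star : StarForest H k
  large : ∀ x ∈ U, #U + 1 ≤ #(colorsAt H k x) + #(outNbrs H k x)

lemma Dense.lt_nbrs_add_outColors (hD : Dense H k U) {x : V} (hx : x ∈ U) :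
    #U + 1 ≤ #(nbrs H x) + #(outColors H k x) :=
  (hD.large x hx).trans (card_colorsAt_add_card_outNbrs_le x)

lemma Dense.goodHeads_pos (hD : Dense H k U) {x : V} (hx : x ∈ U) :
    1 ≤ #(goodHeads H k v x) := by
  have h1 := hD.lt_nbrs_add_outColors hx
  have h2 := card_nbrs_lt hD.mem hx
  have h3 := card_outColors_le_goodHeads (H := H) (k := k) v x
  omega

lemma Dense.full_of_thin (hD : Dense H k U) {x : V} (hx : x ∈ U)
    (h : #(goodHeads H k v x) = 1) : #U ≤ #(nbrs H x) + 1 := by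
  have h1 := hD.lt_nbrs_add_outColors hx
  have h3 := card_outColors_le_goodHeads (H := H) (k := k) v x
  omega

lemma Dense.mem_of_isReps (hD : Dense H k U) (hS : IsReps H k v S) {x : V} (hx : x ∈ S) :
    x ∈ U := hD.mem _ _ (mem_nbrs.1 (hS.1 hx)).symm

lemma Dense.goodHeads_eq (hD : Dense H k U) (hS : IsReps H k v S) {x₁ x₂ : V}
    (h₁ : x₁ ∈ thin H k v S) (h₂ : x₂ ∈ thin H k v S) (hne : x₁ ≠ x₂) :
    goodHeads H k v x₁ = {x₂} := by
  obtain ⟨m₁, c₁⟩ := mem_filter.1 h₁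
  obtain ⟨m₂, c₂⟩ := mem_filter.1 h₂
  exact goodHeads_eq_singleton hD.symm hD.mem hD.noFour hD.star (mem_nbrs.1 (hS.1 m₁))
    (mem_nbrs.1 (hS.1 m₂)) (fun e => hne (hS.2.1 m₁ m₂ e)) c₁ c₂
    (hD.full_of_thin (hD.mem_of_isReps hS m₁) c₁) (hD.full_of_thin (hD.mem_of_isReps hS m₂) c₂)

lemma Dense.card_thin_le (hD : Dense H k U) (hS : IsReps H k v S) : #(thin H k v S) ≤ 2 := by
  by_contra! h
  obtain ⟨a, ha, b, hb, c, hc, hab, hac, hbc⟩ := two_lt_card.1 h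
  have h1 := hD.goodHeads_eq hS ha hb hab
  have h2 := hD.goodHeads_eq hS ha hc hac
  rw [h1] at h2
  exact hbc (singleton_injective h2)

lemma Dense.two_mul_card_le (hD : Dense H k U) (hS : IsReps H k v S) :
    2 * #S ≤ ∑ x ∈ S, #(goodHeads H k v x) + #(thin H k v S) := by
  rw [thin, card_filter, ← sum_add_distrib, mul_comm, ← smul_eq_mul]
  refine card_nsmul_le_sum _ _ _ fun x hx => ?_
  have := hD.goodHeads_pos (v := v) (hD.mem_of_isReps hS hx)
  split_ifs <;> omega

/-- The good heads of the representatives are disjoint and avoid `v`, so they number at most `#U -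
1`; each representative has at least two, except for at most two thin ones. -/
lemma Dense.card_colorsAt_le (hD : Dense H k U) (hv : v ∈ U) :
    2 * #(colorsAt H k v) ≤ #U + 1 := by
  obtain ⟨S, hS⟩ := exists_isReps (H := H) (k := k) v
  have h1 := hD.two_mul_card_le hS
  have h2 := hD.card_thin_le hS
  have h3 := hS.sum_goodHeads_le hD.symm hD.mem hD.noFour hv
  rw [hS.card] at h1
  omega

lemma Dense.card_goodHeads_le_two (hD : Dense H k U) (hv : v ∈ U) (hS : IsReps H k v S)
    (hc : #U + 1 ≤ 2 * #(colorsAt H k v)) {x : V} (hx : x ∈ S) : #(goodHeads H k v x) ≤ 2 := by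
  have h1 : 2 * #S + (if 2 < #(goodHeads H k v x) then 1 else 0) ≤
      ∑ x ∈ S, #(goodHeads H k v x) + #(thin H k v S) := by
    rw [thin, card_filter, ← sum_add_distrib, mul_comm, ← smul_eq_mul, ← sum_const,
      ← sum_erase_add S _ hx, ← sum_erase_add S (fun y => _ + _) hx, add_assoc]
    refine Nat.add_le_add (sum_le_sum fun y hy => ?_) ?_
    · have := hD.goodHeads_pos (v := v) (hD.mem_of_isReps hS (mem_of_mem_erase hy))
      split_ifs <;> omega
    · have := hD.goodHeads_pos (v := v) (hD.mem_of_isReps hS hx)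
      split_ifs <;> omega
  have h2 := hD.card_thin_le hS
  have h3 := hS.sum_goodHeads_le hD.symm hD.mem hD.noFour hv
  rw [← hS.card] at hc
  split_ifs at h1 <;> omega

lemma Dense.exists_two_mul_card_lt (hD : Dense H k U) (hU : 4 ≤ #U) :
    ∃ v ∈ U, 2 * #(colorsAt H k v) < #U + 1 := by
  -- With equality everywhere, each vertex has exactly two thin representatives.
  by_contra! hc
  obtain ⟨v, hv⟩ : U.Nonempty := card_pos.1 (by omega)
  obtain ⟨S, hS⟩ := exists_isReps (H := H) (k := k) v
  have h1 := hD.two_mul_card_le hS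
  have h2 := hD.card_thin_le hS
  have h3 := hS.sum_goodHeads_le hD.symm hD.mem hD.noFour hv
  have hcv := hc v hv
  have hSc := hS.card
  obtain ⟨x₁, x₂, hne, hthin⟩ := card_eq_two.1 (show #(thin H k v S) = 2 by omega)
  have t₁ : x₁ ∈ thin H k v S := by simp [hthin]
  have t₂ : x₂ ∈ thin H k v S := by simp [hthin]
  have g₁ := hD.goodHeads_eq hS t₁ t₂ hne
  have g₂ := hD.goodHeads_eq hS t₂ t₁ hne.symm
  obtain ⟨m₁, c₁⟩ := mem_filter.1 t₁
  obtain ⟨m₂, c₂⟩ := mem_filter.1 t₂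
  obtain ⟨o, -, e⟩ := mem_goodHeads.1 (g₁ ▸ mem_singleton_self x₂ : x₂ ∈ goodHeads H k v x₁)
  have u₁ := hD.mem_of_isReps hS m₁
  have u₂ := hD.mem_of_isReps hS m₂
  -- the arcs leaving `x₁` seen from `x₂`
  have hsub : (outNbrs H k x₁).erase x₂ ⊆ goodHeads H k x₂ x₁ := by
    intro y hy
    obtain ⟨hy2, hy⟩ := mem_erase.1 hy
    refine mem_goodHeads.2 ⟨mem_outNbrs.1 hy, hy2, fun h => hy2 ?_⟩
    have : y ∈ goodHeads H k v x₁ := by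
      refine mem_goodHeads.2 ⟨mem_outNbrs.1 hy, ?_, by rwa [h]⟩
      rintro rfl
      exact e h.symm
    rwa [g₁, mem_singleton] at this
  obtain ⟨S', hS'⟩ := exists_isReps (H := H) (k := k) x₂
  have h5 := hD.card_goodHeads_le_two u₂ hS' (hc _ u₂) (hS'.mem_of_outArc hD.symm o)
  have h6 := card_le_card hsub
  have h7 := pred_card_le_card_erase (s := outNbrs H k x₁) (a := x₂)
  have h8 := hD.large x₁ u₁
  have h9 := hD.card_colorsAt_le u₁
  -- The out-degree of `x₁` is at most 3, so `#U + 1 ≤ (#U + 1) / 2 + 3`; as `#U` is odd by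
  -- equality, it is 5.
  have hS3 : 2 < #S := by omega
  have hU5 : #U = 5 := by omega
  obtain ⟨x₃, hx₃, hn⟩ := exists_mem_notMem_of_card_lt_card
    (show #({x₁, x₂} : Finset V) < #S from card_le_two.trans_lt hS3)
  have hthin₃ : x₃ ∉ thin H k v S := by rwa [hthin]
  simp only [mem_insert, mem_singleton, not_or] at hn
  have u₃ := hD.mem_of_isReps hS hx₃
  have p₃ := hD.goodHeads_pos (v := v) u₃
  have c₃ : #(goodHeads H k v x₃) ≠ 1 := fun h => hthin₃ (mem_filter.2 ⟨hx₃, h⟩)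
  have disj : ∀ {x}, x ∈ S → x ≠ x₃ → Disjoint (goodHeads H k v x) (goodHeads H k v x₃) :=
    fun {x} hx hne => goodHeads_disjoint hD.symm hD.noFour (mem_nbrs.1 (hS.1 hx))
      (mem_nbrs.1 (hS.1 hx₃)) fun h => hne (hS.2.1 hx hx₃ h)
  have d₁ := disj m₁ (Ne.symm hn.1)
  have d₂ := disj m₂ (Ne.symm hn.2)
  rw [g₁, disjoint_singleton_left] at d₁
  rw [g₂, disjoint_singleton_left] at d₂
  -- Only one of the five vertices remains for the at least two good heads of `x₃`.
  have hsub₃ : goodHeads H k v x₃ ⊆ (((U.erase v).erase x₁).erase x₂).erase x₃ := by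
    intro y hy
    obtain ⟨oy, hyv, -⟩ := mem_goodHeads.1 hy
    simp only [mem_erase]
    refine ⟨oy.1.ne', ?_, ?_, hyv, hD.mem _ _ oy.1.symm⟩
    · rintro rfl
      exact d₁ hy
    · rintro rfl
      exact d₂ hy
  have hle := card_le_card hsub₃
  have nv : ∀ {x}, x ∈ S → x ≠ v := fun hx => (mem_nbrs.1 (hS.1 hx)).ne'
  rw [card_erase_of_mem (by simp [hn, nv hx₃, u₃]),
    card_erase_of_mem (by simp [hne.symm, nv m₂, u₂]),
    card_erase_of_mem (by simp [nv m₁, u₁]), card_erase_of_mem hv] at hle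
  omega

lemma Dense.two_mul_sum_lt (hD : Dense H k U) (hU : 4 ≤ #U) :
    2 * ∑ v ∈ U, #(colorsAt H k v) < #U * (#U + 1) := by
  rw [mul_sum, ← smul_eq_mul (#U), ← sum_const]
  exact sum_lt_sum (fun v hv => hD.card_colorsAt_le hv) (hD.exists_two_mul_card_lt hU)

end Dense

/-! ### Induction on the number of vertices -/

lemma outArc_of_card_colorsAt {U : Finset V} (hk : ∀ x y, k x y = k y x)
    (hU : ∀ x y, H.Adj x y → x ∈ U) {t z : V} (ht : t ∈ U) (hc : #U ≤ #(colorsAt H k t) + 1)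
    (hz : z ∈ U) (hne : z ≠ t) : OutArc H k z t := by
  have h1 := card_nbrs_lt hU ht
  have h2 := card_colorsAt_le (H := H) (k := k) t
  have hadj : H.Adj t z := adj_of_card_nbrs hU ht (by omega) hz hne
  have hinj : Set.InjOn (k t) (nbrs H t) :=
    card_image_iff.1 (show #(colorsAt H k t) = #(nbrs H t) by omega)
  refine ⟨hadj.symm, fun y hy e => hinj (mem_nbrs.2 hy.symm) (mem_nbrs.2 hadj) ?_⟩
  rw [hk t y, e, hk]

lemma IsCore.card_colorsAt {U T : Finset V} (hk : ∀ x y, k x y = k y x) (hT : IsCore H k U T)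
    {t : V} (ht : t ∈ T) : #U ≤ #(colorsAt H k t) + 1 := by
  rw [← card_erase_add_one (hT.1 ht)]
  refine Nat.add_le_add_right ?_ 1
  rw [← card_image_of_injOn (f := k t) (s := U.erase t)]
  · refine card_le_card (image_subset_image fun z hz => ?_)
    obtain ⟨hne, hz⟩ := mem_erase.1 hz
    exact mem_nbrs.2 (hT.2.2 t ht z hz hne).1.symm
  · intro y hy z hz e
    obtain ⟨hy1, hy2⟩ := mem_erase.1 hy
    obtain ⟨hz1, hz2⟩ := mem_erase.1 hz
    exact (hT.2.2 t ht z hz2 hz1).2 y (hT.2.2 t ht y hy2 hy1).1 (by rw [hk y, hk z]; exact e)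

lemma sum_colorsAt_eq {U : Finset V} (hU : ∀ x y, H.Adj x y → x ∈ U) :
    ∑ v ∈ U, #(colorsAt H k v) = ∑ v, #(colorsAt H k v) := by
  refine sum_subset (subset_univ _) fun v _ hv => ?_
  rw [colorsAt_eq_empty hU hv, card_empty]

/-- Color degrees are at most `#U - 1`, so the sum can be reached only by a rainbow triangle, which
is its own core. -/
lemma exists_isCore_of_card_le_three {U : Finset V} (hk : ∀ x y, k x y = k y x)
    (hU : ∀ x y, H.Adj x y → x ∈ U) (h1 : 1 ≤ #U) (h3 : #U ≤ 3)
    (hsum : #U * (#U + 1) ≤ 2 * ∑ v, #(colorsAt H k v)) :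
    2 * ∑ v, #(colorsAt H k v) = #U * (#U + 1) ∧ ∃ T, IsCore H k U T := by
  have hle : ∀ v ∈ U, #(colorsAt H k v) ≤ #U - 1 := by
    intro v hv
    have := card_nbrs_lt hU hv
    have := card_colorsAt_le (H := H) (k := k) v
    omega
  have hsum' := sum_le_sum hle
  rw [sum_const, smul_eq_mul] at hsum'
  rw [← sum_colorsAt_eq hU] at hsum ⊢
  obtain h | h | h : #U = 1 ∨ #U = 2 ∨ #U = 3 := by omega
  · simp only [h] at hsum hsum'
    omega
  · simp only [h] at hsum hsum'
    omega
  · refine ⟨by simp only [h] at hsum hsum' ⊢; omega, U, Subset.rfl, h, fun t ht z hz hne => ?_⟩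
    refine outArc_of_card_colorsAt hk hU ht ?_ hz hne
    by_contra! hlt
    have := sum_lt_sum hle ⟨t, ht, by omega⟩
    rw [sum_const, smul_eq_mul] at this
    simp only [h] at hsum this
    omega

theorem exists_isCore (hk : ∀ x y, k x y = k y x) (n : ℕ) : ∀ (H : SimpleGraph V) (U : Finset V),
    #U = n → 1 ≤ n → (∀ x y, H.Adj x y → x ∈ U) → NoPCFour H k → StarForest H k →
    n * (n + 1) ≤ 2 * ∑ v, #(colorsAt H k v) →
    2 * ∑ v, #(colorsAt H k v) = n * (n + 1) ∧ ∃ T, IsCore H k U T := by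
  induction n with
  | zero => intro H U _ h; omega
  | succ n ih =>
    intro H U hn h1 hU h4 hs hsum
    by_cases hn3 : n + 1 ≤ 3
    · have := exists_isCore_of_card_le_three hk hU (by omega) (by omega) (by rwa [hn])
      rwa [hn] at this
    by_cases hx : ∃ x ∈ U, #(colorsAt H k x) + #(outNbrs H k x) ≤ n + 1
    · obtain ⟨x, hxU, hx⟩ := hx
      have hdel := sum_colorsAt_le_isolate (H := H) hk x
      have hU' : ∀ y z, (isolate H x).Adj y z → y ∈ U.erase x := fun y z h =>
        mem_erase.2 ⟨h.2.1, hU _ _ h.1⟩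
      have harith : (n + 1) * (n + 1 + 1) = n * (n + 1) + 2 * (n + 1) := by ring
      obtain ⟨heq, T, hT⟩ := ih (isolate H x) (U.erase x) (by rw [card_erase_of_mem hxU]; omega)
        (by omega) hU' (h4.mono (isolate_le x)) (hs.isolate x) (by omega)
      refine ⟨by omega, T, ?_⟩
      have hdeg := card_colorsAt_add_card_outNbrs_le (H := H) (k := k) x
      have hlt := card_nbrs_lt hU hxU
      -- The deletion loses exactly `n + 1`, so `x` has exactly one out-color and all `n` other
      -- vertices as neighbors.
      have hone : #(outColors H k x) ≤ 1 := by
        refine card_le_one.2 fun a ha b hb => ?_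
        obtain ⟨y, hy, rfl⟩ := mem_image.1 ha
        obtain ⟨z, hz, rfl⟩ := mem_image.1 hb
        exact hT.outColor_unique hk hU h4 (mem_outNbrs.1 hy) (mem_outNbrs.1 hz)
      obtain ⟨w, hw⟩ : (outNbrs H k x).Nonempty := by
        rw [← image_nonempty (f := k x)]
        refine card_pos.1 (?_ : 0 < #(outColors H k x))
        omega
      refine hT.extend hk hU h4 hs (fun t ht => ?_) (mem_outNbrs.1 hw)
      obtain ⟨htx, htU⟩ := mem_erase.1 (hT.1 ht)
      exact adj_of_card_nbrs hU hxU (by omega) htU htx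
    · push Not at hx
      have hD : Dense H k U := ⟨hk, hU, h4, hs, fun x hxU => by rw [hn]; exact hx x hxU⟩
      have := hD.two_mul_sum_lt (by omega)
      rw [sum_colorsAt_eq hU, hn] at this
      omega

/-! ### Reduction to star forests and conclusion -/

lemma colorsAt_deleteEdges (hk : ∀ x y, k x y = k y x) {x y : V} (hx : H.Adj x y)
    (h1 : ¬ OutArc H k x y) (h2 : ¬ OutArc H k y x) (v : V) :
    colorsAt H k v ⊆ colorsAt (H.deleteEdges {s(x, y)}) k v := by
  have other : ∀ {p q}, H.Adj p q → ¬ OutArc H k p q →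
      k q p ∈ colorsAt (H.deleteEdges {s(p, q)}) k q := by
    intro p q hpq ho
    rw [OutArc] at ho
    push Not at ho
    obtain ⟨z, hz, e, hne⟩ := ho hpq
    refine mem_image.2 ⟨z, mem_nbrs.2 ?_, by rw [hk q, e, hk]⟩
    rw [SimpleGraph.deleteEdges_adj]
    refine ⟨hz.symm, fun h => ?_⟩
    rw [Set.mem_singleton_iff, Sym2.eq_iff] at h
    rcases h with h | h
    · exact hpq.ne h.1.symm
    · exact hne h.2
  intro a ha
  obtain ⟨w, hw, rfl⟩ := mem_image.1 ha
  rw [mem_nbrs] at hw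
  by_cases h : s(v, w) = s(x, y)
  · rcases Sym2.eq_iff.1 h with ⟨rfl, rfl⟩ | ⟨rfl, rfl⟩
    · rw [Sym2.eq_swap]
      exact other hx.symm h2
    · exact other hx h1
  · refine mem_image.2 ⟨w, mem_nbrs.2 ?_, rfl⟩
    simpa [SimpleGraph.deleteEdges_adj] using ⟨hw, by simpa using h⟩

lemma exists_starForest (hk : ∀ x y, k x y = k y x) (G : SimpleGraph V) (n : ℕ)
    (hG : ∀ v, n ≤ 2 * #(colorsAt G k v)) :
    ∃ H ≤ G, StarForest H k ∧ ∀ v, n ≤ 2 * #(colorsAt H k v) := by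
  obtain ⟨H, hle, hH⟩ := exists_minimal_le_of_wellFoundedLT
    (fun H : SimpleGraph V => ∀ v, n ≤ 2 * #(colorsAt H k v)) G hG
  refine ⟨H, hle, fun x y hx => ?_, hH.1⟩
  by_contra! ho
  have hle' := hH.2 (y := H.deleteEdges {s(x, y)}) (fun v => (hH.1 v).trans
    (Nat.mul_le_mul_left 2 (card_le_card (colorsAt_deleteEdges hk hx ho.1 ho.2 v))))
    (SimpleGraph.deleteEdges_le _)
  have := hle' hx
  simp [SimpleGraph.deleteEdges_adj] at this

theorem not_noPCFour (hk : ∀ x y, k x y = k y x) (G : SimpleGraph V) (hn : 4 ≤ Fintype.card V)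
    (hG : ∀ v, Fintype.card V + 1 ≤ 2 * #(colorsAt G k v)) : ¬ NoPCFour G k := by
  intro h4
  obtain ⟨H, hle, hs, hH⟩ := exists_starForest hk G _ hG
  have hconst : ∑ _v : V, (Fintype.card V + 1) = Fintype.card V * (Fintype.card V + 1) := by
    simp
  have hsum : Fintype.card V * (Fintype.card V + 1) ≤ 2 * ∑ v, #(colorsAt H k v) := by
    rw [← hconst, mul_sum]
    exact sum_le_sum fun v _ => hH v
  obtain ⟨heq, T, hT⟩ := exists_isCore hk _ H univ rfl (by rw [card_univ]; omega)
    (fun _ _ _ => mem_univ _) (h4.mono hle) hs hsum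
  obtain ⟨t, ht⟩ : T.Nonempty := card_pos.1 (by rw [hT.2.1]; omega)
  have hc := hT.card_colorsAt hk ht
  rw [card_univ] at hc heq
  -- Strict at `t`, because `2 * (n - 1) > n + 1` for `n ≥ 4`.
  have hlt : ∑ _v : V, (Fintype.card V + 1) < ∑ v, 2 * #(colorsAt H k v) :=
    sum_lt_sum (fun v _ => hH v) ⟨t, mem_univ t, by omega⟩
  rw [hconst, ← mul_sum] at hlt
  omega

end PCFourCycle

/-! ### Transfer to edge labelings and subgraphs -/

section Transfer

open scoped Classical

variable {V K : Type*} {G : SimpleGraph V}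

/-- The color of an edge, and `none` for a pair that is not an edge. -/
noncomputable def pairColor (c : G.EdgeLabeling K) (v w : V) : Option K :=
  if h : G.Adj v w then some (c.get v w h) else none

lemma pairColor_of_adj (c : G.EdgeLabeling K) {v w : V} (h : G.Adj v w) :
    pairColor c v w = some (c.get v w h) := dif_pos h

lemma pairColor_comm (c : G.EdgeLabeling K) (v w : V) : pairColor c v w = pairColor c w v := by
  by_cases h : G.Adj v w
  · rw [pairColor_of_adj c h, pairColor_of_adj c h.symm, c.get_comm]
  · rw [pairColor, pairColor, dif_neg h, dif_neg fun h' => h h'.symm]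

lemma colorDegree_eq_card [Fintype V] (c : G.EdgeLabeling K) (v : V) :
    colorDegree c v = #(colorsAt G (pairColor c) v) := by
  rw [colorDegree, ← Set.ncard_image_of_injective _ (Option.some_injective K),
    ← Set.ncard_coe_finset]
  congr 1
  ext a
  simp only [Set.mem_image, Set.mem_ofPred_eq, colorsAt, coe_image, mem_coe, mem_nbrs]
  constructor
  · rintro ⟨_, ⟨w, h, rfl⟩, rfl⟩
    exact ⟨w, h, pairColor_of_adj c h⟩
  · rintro ⟨w, h, rfl⟩
    exact ⟨_, ⟨w, h, rfl⟩, (pairColor_of_adj c h).symm⟩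

lemma containsProperlyColored_cycleGraph_four (c : G.EdgeLabeling K)
    (h : ¬ NoPCFour G (pairColor c)) :
    ContainsProperlyColored c (SimpleGraph.cycleGraph 4) := by
  rw [NoPCFour] at h
  push Not at h
  obtain ⟨a₀, a₁, a₂, a₃, h01, h12, h23, h30, n1, n2, n3, n0, -⟩ := h
  have h02 : a₀ ≠ a₂ := by rintro rfl; exact n1 rfl
  have h13 : a₁ ≠ a₃ := by rintro rfl; exact n2 rfl
  let f : Fin 4 → V := ![a₀, a₁, a₂, a₃]
  have hinj : Function.Injective f := by
    intro i j
    fin_cases i <;> fin_cases j <;>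
      simp [f, h01.ne, h01.ne', h12.ne, h12.ne', h23.ne, h23.ne', h30.ne, h30.ne', h02, h02.symm,
        h13, h13.symm]
  have hadj : ∀ {i j}, (SimpleGraph.cycleGraph 4).Adj i j → G.Adj (f i) (f j) := by
    intro i j hij
    fin_cases i <;> fin_cases j <;> first
      | exact absurd hij (by decide)
      | simp [f, h01, h01.symm, h12, h12.symm, h23, h23.symm, h30, h30.symm]
  have hcol : ∀ {i j j'}, (SimpleGraph.cycleGraph 4).Adj i j →
      (SimpleGraph.cycleGraph 4).Adj i j' → j ≠ j' →
      pairColor c (f i) (f j) ≠ pairColor c (f i) (f j') := by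
    intro i j j' hij hij' hne
    fin_cases i <;> fin_cases j <;> first
      | exact absurd hij (by decide)
      | fin_cases j' <;> first
        | exact absurd hij' (by decide)
        | exact absurd rfl hne
        | simp [f, n0, n0.symm, n1, n1.symm, n2, n2.symm, n3, n3.symm]
  let F : SimpleGraph.Copy (SimpleGraph.cycleGraph 4) G := ⟨⟨f, hadj⟩, hinj⟩
  refine ⟨F.toSubgraph, ⟨F.isoToSubgraph⟩, ?_⟩
  intro v w w' hw hw' hne e
  have hp : pairColor c v w = pairColor c v w' := by
    rw [pairColor_of_adj c hw.adj_sub, pairColor_of_adj c hw'.adj_sub, e]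
  obtain ⟨i, j, hij, rfl, rfl⟩ := hw
  obtain ⟨i', j', hij', hi, rfl⟩ := hw'
  obtain rfl : i' = i := hinj hi
  exact hcol hij hij' (fun h => hne (h ▸ rfl)) hp

end Transfer

end EdgeColored

theorem mainTheorem5 {V K : Type*} [Fintype V] (G : SimpleGraph V) (c : G.EdgeLabeling K)
    (hn : 4 ≤ Fintype.card V)
    (hdeg : ∀ v : V, ((Fintype.card V : ℝ) + 1) / 2 ≤ (EdgeColored.colorDegree c v : ℝ)) :
    EdgeColored.ContainsProperlyColored c (SimpleGraph.cycleGraph 4) := by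
  refine EdgeColored.containsProperlyColored_cycleGraph_four c
    (EdgeColored.not_noPCFour (EdgeColored.pairColor_comm c) G hn fun v => ?_)
  have h := hdeg v
  rw [EdgeColored.colorDegree_eq_card, div_le_iff₀ two_pos] at h
  rw [mul_comm]
  exact_mod_cast h
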